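/- **Theorem 3.** Let $n>1$. Scheme 2 is the following protocol between Alice, who holds $n$ data qubits and one phase qubit, and Bob, who knows the circuit. Its allowed $n$-qubit logical circuits are the finite products of (a) real unitaries on the $n$ data qubits that are diagonal in the product eigenbasis of $\sigma_y^{\otimes n}$ ("real $Y$-diagonal unitaries", known only to Bob) and (b) gates $R_z(j\pi/2)=\mathrm{diag}(1,e^{ij\pi/2})$, $j\in\{1,3\}$, on individual data qubits. The $n$-qubit input $\sum_x(a_x+ib_x)|x\rangle$ (with $a_x,b_x$ real) is encoded as $\sum_x |x\rangle(a_x|R\rangle+b_x|I\rangle)$, where $|R\rangle=|0\rangle$ and $|I\rangle=|1\rangle$ on the phase qubit. Write $R_y(\theta)=\begin{pmatrix}\cos\frac\theta2&-\sin\frac\theta2\\ \sin\frac\theta2&\cos\frac\theta2\end{pmatrix}$. A gate $R_z(j\pi/2)$ is performed by Alice as a controlled-$R_y(j\pi)$ from the data qubit to the phase qubit. A unitary $U=\sum_{f\in\{0,1\}^n}c(f)\,V(f)$ of type (a), with $V(f)=\bigotimes_i\sigma_y^{f_i}$, is performed with one EPR pair per data qubit: Alice applies controlled-$i\sigma_y$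 from each of her halves to the data qubit, then $R_y(\pi/2)$ to her half, and measures it in the $Z$ basis; Bob applies to his half a $Z$ if the pending Pauli correction on that data qubit is $X$ or $Z$, then $P$ or $P^\dagger$ ($P=\mathrm{diag}(1,i)$) according to Alice's outcome $0$ or $1$, then to all his halves the matrix $C_{g,f}=c(g^{-1}f)$, and measures in the $Z$ basis, each outcome $1$ adding a correction $R_y(\pi)$ on the data qubit. Bob propagates the corrections through the circuit, and Alice applies them at the end. The scheme *maps* $\psi$ to $\varphi$ if for all measurement outcomes that can occur the final state is, up to a global phase, the encoding of $e^{i\theta}\varphi$ for some real $\theta$; a circuit maps $\psi$ to $\varphi$ if its logical unitary $L$ satisfies $L\psi=e^{i\theta}\varphi$ for some real $\theta$. (i) The allowed circuits do not include all circuits on $n$ qubits: there is a unitary $W$ on $n$ qubits such that no allowed circuit has logical unitary $e^{i\theta}W$ with $\theta$ real, and for no allowed circuit does the scheme map every pure $n$-qubit state $\psi$ to $W\psi$. (ii) If $n$ is even, the logical Hadamard gate on the rebit encoded as $|0\rangle^{\otimes n},|1\rangle^{\otimes n}$ is impossible: no allowed circuit, and no run of the scheme for an allowed circuit, maps both $|0\rangle^{\otimes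 n}$ to $\frac1{\sqrt2}(|0\rangle^{\otimes n}+|1\rangle^{\otimes n})$ and $|1\rangle^{\otimes n}$ to $\frac1{\sqrt2}(|0\rangle^{\otimes n}-|1\rangle^{\otimes n})$. (iii) If $n$ is odd, no allowed circuit, and no run of the scheme for an allowed circuit, maps both $|0\rangle^{\otimes n}$ to itself and $|1\rangle^{\otimes n}$ to $|0\rangle^{\otimes(n-1)}|1\rangle$; in particular the permutation of basis states that exchanges $|1\rangle^{\otimes n}$ and $|0\rangle^{\otimes(n-1)}|1\rangle$ and fixes the others is impossible. -/

import Mathlib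

open scoped Matrix

noncomputable section

namespace RebitScheme

/-- Computational-basis labels of `n` qubits; under addition, the group `C₂ⁿ`. -/
abbrev Bits (n : ℕ) : Type := Fin n → Fin 2

/-- Operators on `n` qubits, as matrices in the computational basis. -/
abbrev Op (n : ℕ) : Type := Matrix (Bits n) (Bits n) ℂ

/-! ### One-qubit gates -/

def sigmaX : Matrix (Fin 2) (Fin 2) ℂ := !![0, 1; 1, 0]

def sigmaY : Matrix (Fin 2) (Fin 2) ℂ := !![0, -Complex.I; Complex.I, 0]

def sigmaZ : Matrix (Fin 2) (Fin 2) ℂ := !![1, 0; 0, -1]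

/-- The phase gate `P = diag(1, i)`. -/
def gateP : Matrix (Fin 2) (Fin 2) ℂ := !![1, 0; 0, Complex.I]

def Ry (θ : ℝ) : Matrix (Fin 2) (Fin 2) ℂ :=
  !![(Real.cos (θ / 2) : ℂ), -(Real.sin (θ / 2) : ℂ);
     (Real.sin (θ / 2) : ℂ), (Real.cos (θ / 2) : ℂ)]

def Rz (θ : ℝ) : Matrix (Fin 2) (Fin 2) ℂ :=
  !![1, 0; 0, Complex.exp (θ * Complex.I)]

/-! ### `n`-qubit operators -/

/-- The tensor product `A 0 ⊗ ⋯ ⊗ A (n - 1)` of one-qubit operators. -/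
def tensor {n : ℕ} (A : Fin n → Matrix (Fin 2) (Fin 2) ℂ) : Op n :=
  Matrix.of fun x y => ∏ i, A i (x i) (y i)

/-- The one-qubit operator `A` acting on qubit `i`. -/
def onQubit {n : ℕ} (i : Fin n) (A : Matrix (Fin 2) (Fin 2) ℂ) : Op n :=
  tensor (Function.update (fun _ => 1) i A)

/-- `V(f) = ⨂ᵢ σ_y ^ fᵢ`. -/
def V {n : ℕ} (f : Bits n) : Op n := tensor fun i => sigmaY ^ (f i : ℕ)

/-- The eigenvectors of `σ_y`: `(|0⟩ + i|1⟩)/√2` for `0` and `(|0⟩ - i|1⟩)/√2` for `1`. -/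
def yVec (s : Fin 2) : Fin 2 → ℂ :=
  ![((Real.sqrt 2)⁻¹ : ℂ), (-1) ^ (s : ℕ) * Complex.I * ((Real.sqrt 2)⁻¹ : ℂ)]

/-- The product basis of eigenvectors of `σ_y`. -/
def yBasis {n : ℕ} (s : Bits n) : Bits n → ℂ := fun x => ∏ i, yVec (s i) (x i)

/-- A unitary with real entries which is diagonal in the product `Y` basis. -/
structure IsRealYDiagonalUnitary {n : ℕ} (U : Op n) : Prop where
  unitary : U ∈ Matrix.unitaryGroup (Bits n) ℂ
  real : ∀ x y, (U x y).im = 0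
  yDiagonal : ∀ s : Bits n, ∃ μ : ℂ, U *ᵥ yBasis s = μ • yBasis s

/-! ### Logical circuits -/

/-- One step of a logical circuit: a real `Y`-diagonal unitary on the `n` data qubits, or
`R_z(jπ/2)` with `j ∈ {1, 3}` on one data qubit. -/
inductive Step (n : ℕ) : Type
  | ydiag (U : Op n) (hU : IsRealYDiagonalUnitary U) : Step n
  | rz (i : Fin n) (j : ℕ) (hj : j = 1 ∨ j = 3) : Step n

/-- An allowed logical circuit; the head of the list is applied first. -/
abbrev Circuit (n : ℕ) : Type := List (Step n)

def Step.logical {n : ℕ} : Step n → Op n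
  | .ydiag U _ => U
  | .rz i j _ => onQubit i (Rz (j * Real.pi / 2))

/-- The unitary on `n` logical qubits performed by a circuit. -/
def logical {n : ℕ} : Circuit n → Op n
  | [] => 1
  | s :: p => logical p * s.logical

/-! ### The two-party protocol -/

/-- Amplitudes of Alice's `n` data qubits and her phase qubit (`0` is `R`, `1` is `I`). -/
abbrev AliceVec (n : ℕ) : Type := Bits n → Fin 2 → ℂ

/-- The rebit encoding: `∑ (aₓ + i bₓ)|x⟩ ↦ ∑ aₓ|x⟩|R⟩ + bₓ|x⟩|I⟩`. -/
def encode {n : ℕ} (ψ : Bits n → ℂ) : AliceVec n :=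
  fun x p => if p = 0 then ((ψ x).re : ℂ) else ((ψ x).im : ℂ)

/-- Bob's list of pending Pauli corrections, up to sign: `X ^ xᵢ Z ^ zᵢ` on data qubit `i`
(so `R_y(π)` is `xᵢ = zᵢ = 1`) and `R_y(π) ^ w` on the phase qubit. -/
structure PauliList (n : ℕ) where
  x : Bits n
  z : Bits n
  w : Fin 2

def PauliList.none (n : ℕ) : PauliList n := ⟨0, 0, 0⟩

/-- Update after Bob's outcomes `s` in a layer of gadgets: an extra `R_y(π)` on data qubit `i`
for each `sᵢ = 1`. -/
def PauliList.afterGadgets {n : ℕ} (Q : PauliList n) (s : Bits n) : PauliList n :=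
  ⟨Q.x + s, Q.z + s, Q.w⟩

/-- Update on passing a controlled-`R_y(±π)` from data qubit `i` to the phase qubit: an `X` on
the control becomes `XZ` on the control and `R_y(π)` on the target; the rest commutes. -/
def PauliList.afterControlled {n : ℕ} (Q : PauliList n) (i : Fin n) : PauliList n :=
  ⟨Q.x, Function.update Q.z i (Q.z i + Q.x i), Q.w + Q.x i⟩

/-- Controlled-`R_y(jπ)` with data qubit `i` as control and the phase qubit as target. -/
def controlledRy {n : ℕ} (i : Fin n) (j : ℕ) (Φ : AliceVec n) : AliceVec n :=
  fun x p => ∑ q, (Ry (j * Real.pi) ^ (x i : ℕ)) p q * Φ x q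

/-- Amplitudes of Alice's data and phase qubits, her halves `a` and Bob's halves `b` of the EPR
pairs of a layer of gadgets. -/
abbrev GadgetVec (n : ℕ) : Type := Bits n → Fin 2 → Bits n → Bits n → ℂ

/-- Add `n` EPR pairs `(|00⟩ + |11⟩)/√2`. -/
def attachEPR {n : ℕ} (Φ : AliceVec n) : GadgetVec n :=
  fun x p a b => Φ x p * ∏ i, if a i = b i then ((Real.sqrt 2)⁻¹ : ℂ) else 0

/-- Alice's controlled-`iσ_y` gates, with control `aᵢ` and target data qubit `i`, for all `i`. -/
def aliceControlled {n : ℕ} (Ψ : GadgetVec n) : GadgetVec n :=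
  fun x p a b => ∑ y, tensor (fun i => (Complex.I • sigmaY) ^ (a i : ℕ)) x y * Ψ y p a b

/-- Alice applies `R_y(π/2)` to each of her halves and measures them in the `Z` basis, with
outcomes `m`; the result is the unnormalized state of her data and phase qubits and of Bob's
qubits. -/
def aliceMeasure {n : ℕ} (m : Bits n) (Ψ : GadgetVec n) : Bits n → Fin 2 → Bits n → ℂ :=
  fun x p b => ∑ a, tensor (fun _ => Ry (Real.pi / 2)) m a * Ψ x p a b

/-- The coefficients of `U = ∑ f, c(f) V(f)`, for `U` diagonal in the `Y` basis. -/
def coeff {n : ℕ} (U : Op n) (f : Bits n) : ℂ := ((2 : ℂ) ^ n)⁻¹ * (V f * U).trace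

/-- Bob's matrix `C_{g,f} = c(g⁻¹ f)`. -/
def bobC {n : ℕ} (U : Op n) : Op n := Matrix.of fun g f => coeff U (-g + f)

/-- Bob's one-qubit gates: `P` or `P†` according to Alice's outcome, preceded by `Z` where the
list of corrections has `X` or `Z` (and not their product) on the data qubit. -/
def bobLocal {n : ℕ} (Q : PauliList n) (m : Bits n) : Op n :=
  tensor fun i => (if m i = 0 then gateP else gatePᴴ) * sigmaZ ^ ((Q.x i + Q.z i : Fin 2) : ℕ)

/-- Bob applies his one-qubit gates and `C` and measures in the `Z` basis, with outcomes `s`; the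
result is the unnormalized state of Alice's data and phase qubits. -/
def bobMeasure {n : ℕ} (U : Op n) (Q : PauliList n) (m s : Bits n)
    (Ψ : Bits n → Fin 2 → Bits n → ℂ) : AliceVec n :=
  fun x p => ∑ b, (bobC U * bobLocal Q m) s b * Ψ x p b

/-- A whole layer of gadgets for `U`, given the corrections `Q` pending before it and the outcomes
`m` of Alice and `s` of Bob. -/
def gadgets {n : ℕ} (U : Op n) (Q : PauliList n) (m s : Bits n) (Φ : AliceVec n) : AliceVec n :=
  bobMeasure U Q m s (aliceMeasure m (aliceControlled (attachEPR Φ)))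

/-- Alice applies the corrections at the end. -/
def correct {n : ℕ} (Q : PauliList n) (Φ : AliceVec n) : AliceVec n :=
  fun x p => ∑ y, ∑ q, tensor (fun i => sigmaZ ^ (Q.z i : ℕ) * sigmaX ^ (Q.x i : ℕ)) x y *
    (((Ry Real.pi)ᴴ) ^ (Q.w : ℕ)) p q * Φ y q

/-- The unnormalized final state of Alice for given measurement outcomes: `o k` holds the outcomes
of Alice and of Bob in the `k`-th layer of gadgets. Alice's operations do not depend on Bob's
outcomes, and the two parties act on different systems, so running the layers one after the other
is the same as Alice acting on all of them first and then Bob. -/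
def run {n : ℕ} : Circuit n → (ℕ → Bits n × Bits n) → PauliList n → AliceVec n → AliceVec n
  | [], _, Q, Φ => correct Q Φ
  | .ydiag U _ :: p, o, Q, Φ =>
      run p (fun k => o (k + 1)) (Q.afterGadgets (o 0).2) (gadgets U Q (o 0).1 (o 0).2 Φ)
  | .rz i j _ :: p, o, Q, Φ => run p o (Q.afterControlled i) (controlledRy i j Φ)

/-- The output of the scheme on the `n`-qubit input `ψ`. -/
def output {n : ℕ} (p : Circuit n) (o : ℕ → Bits n × Bits n) (ψ : Bits n → ℂ) : AliceVec n :=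
  run p o (PauliList.none n) (encode ψ)

/-! ### What a circuit and the scheme do to a state -/

/-- The logical circuit takes `ψ` to `φ` up to a global phase. -/
def CircuitMaps {n : ℕ} (p : Circuit n) (ψ φ : Bits n → ℂ) : Prop :=
  ∃ θ : ℝ, logical p *ᵥ ψ = Complex.exp (θ * Complex.I) • φ

/-- The scheme, run for the circuit `p`, takes `ψ` to `φ` deterministically: for all measurement
outcomes the output is the encoding of `φ`, up to the normalization and the phase `c` of the
physical state and a phase `θ` of the logical state (a rotation of the phase qubit). Outcomes of
probability zero, where the output is the zero vector, carry no condition: there `c = 0` will do. -/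
def SchemeMaps {n : ℕ} (p : Circuit n) (ψ φ : Bits n → ℂ) : Prop :=
  ∀ o : ℕ → Bits n × Bits n, ∃ (c : ℂ) (θ : ℝ),
    output p o ψ = c • encode (Complex.exp (θ * Complex.I) • φ)

/-- The logical circuit `p` is the unitary `W` up to a global phase. -/
def CircuitIs {n : ℕ} (p : Circuit n) (W : Op n) : Prop :=
  ∃ θ : ℝ, logical p = Complex.exp (θ * Complex.I) • W

/-- The scheme, run for `p`, performs `W` deterministically on all pure `n`-qubit inputs. -/
def SchemeRealizes {n : ℕ} (p : Circuit n) (W : Op n) : Prop :=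
  ∀ ψ : Bits n → ℂ, ∑ x, ‖ψ x‖ ^ 2 = 1 → SchemeMaps p ψ (W *ᵥ ψ)

/-! ### Particular states -/

/-- The basis vector `|x⟩`. -/
def ket {n : ℕ} (x : Bits n) : Bits n → ℂ := Pi.single x 1

def allZero (n : ℕ) : Bits n := fun _ => 0

def allOne (n : ℕ) : Bits n := fun _ => 1

/-- The string `0⋯01`. -/
def lastOne (n : ℕ) : Bits n := fun i => if (i : ℕ) + 1 = n then 1 else 0

end RebitScheme

end

noncomputable section

namespace RebitScheme


/-! ### Tensor products -/

/-! The obstruction is an invariant: every allowed logical unitary preserves the bilinear (not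
sesquilinear) form S(ψ, φ) = ψᵀ σ_y^{⊗n} φ up to a nonzero scalar. A real Y-diagonal U satisfies UᵀU
= 1 and commutes with σ_y^{⊗n}. A gate R_z(jπ/2) = diag(1, ±i) multiplies S by ±i, because S pairs
only complementary bit strings (`logical_form`).

Now S(|0…0⟩, |1…1⟩) ≠ 0, while S(|0…0⟩, |0…01⟩) = 0 because for n > 1 both strings begin with 0. So
no circuit fixes |0…0⟩ and takes |1…1⟩ to |0…01⟩, even up to separate scalars; the transposition of
|1…1⟩ and |0…01⟩ therefore serves as W. For even n the form is symmetric, so |0…0⟩ + |1…1⟩ is not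
isotropic, whereas |0…0⟩ is; this excludes the Hadamard gate.

The scheme is reduced to the logical circuit by a Pauli-frame simulation. For fixed outcomes,
Alice's state is always a nonzero multiple of the correct encoded state with Bob's listed
corrections applied. `gadgets_frame` and `controlledMat_frame` propagate this through the two kinds
of step, and `output_eq` concludes that the output encodes the logical output up to a nonzero
scalar. -/

theorem tensor_apply {n : ℕ} (A : Fin n → Matrix (Fin 2) (Fin 2) ℂ) (x y : Bits n) :
    tensor A x y = ∏ i, A i (x i) (y i) := rfl

theorem tensor_mul {n : ℕ} (A B : Fin n → Matrix (Fin 2) (Fin 2) ℂ) :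
    tensor A * tensor B = tensor fun i => A i * B i := by
  ext x y
  simp only [Matrix.mul_apply, tensor_apply]
  rw [Finset.prod_univ_sum, Fintype.piFinset_univ]
  simp only [Finset.prod_mul_distrib]

theorem tensor_diagonal {n : ℕ} (d : Fin n → Fin 2 → ℂ) :
    tensor (fun i => Matrix.diagonal (d i)) = Matrix.diagonal fun x => ∏ i, d i (x i) := by
  ext x y
  rw [tensor_apply, Matrix.diagonal_apply]
  split_ifs with h
  · subst h; simp
  · obtain ⟨i, hi⟩ := Function.ne_iff.mp h
    exact Finset.prod_eq_zero (Finset.mem_univ i) (Matrix.diagonal_apply_ne _ hi)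

theorem tensor_one {n : ℕ} : tensor (fun _ : Fin n => 1) = 1 := by
  have h := tensor_diagonal (n := n) fun _ _ => 1
  simpa using h

theorem tensor_smul {n : ℕ} (c : Fin n → ℂ) (A : Fin n → Matrix (Fin 2) (Fin 2) ℂ) :
    tensor (fun i => c i • A i) = (∏ i, c i) • tensor A := by
  ext x y
  simp [tensor_apply, Finset.prod_mul_distrib]

theorem onQubit_diagonal {n : ℕ} (i : Fin n) (d : Fin 2 → ℂ) :
    onQubit i (Matrix.diagonal d) = Matrix.diagonal fun x => d (x i) := by
  have h := tensor_diagonal (Function.update (fun _ _ => 1) i d)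
  have e : (fun k => Matrix.diagonal (Function.update (fun (_ : Fin n) (_ : Fin 2) => (1 : ℂ)) i d k))
      = Function.update (fun _ => 1) i (Matrix.diagonal d) := by
    funext k
    rcases eq_or_ne k i with rfl | hk
    · simp
    · simp [hk]
  rw [e] at h
  rw [onQubit, h]
  congr 1
  funext x
  rw [Finset.prod_eq_single i]
  · simp
  · intro k _ hk; simp [hk]
  · simp

/-! ### The product `Y` basis -/

theorem inv_sqrt_two_mul_self : ((Real.sqrt 2 : ℝ) : ℂ)⁻¹ * ((Real.sqrt 2 : ℝ) : ℂ)⁻¹ = 2⁻¹ := by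
  rw [← mul_inv, ← Complex.ofReal_mul, Real.mul_self_sqrt (by norm_num)]
  simp

/-- The unitary whose columns are the eigenvectors of `σ_y`. -/
def yMat : Matrix (Fin 2) (Fin 2) ℂ := Matrix.of fun x s => yVec s x

theorem yMat_mul_conjTranspose : yMat * yMatᴴ = 1 := by
  ext a b
  fin_cases a <;> fin_cases b <;>
    simp [yMat, yVec, Matrix.mul_apply, mul_mul_mul_comm, inv_sqrt_two_mul_self]; ring_nf

theorem sigmaY_pow_mul_yMat (g : Fin 2) :
    sigmaY ^ (g : ℕ) * yMat = yMat * Matrix.diagonal fun s : Fin 2 => (-1) ^ ((g : ℕ) * (s : ℕ)) := by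
  ext a b
  fin_cases g <;> fin_cases a <;> fin_cases b <;>
    simp [yMat, yVec, sigmaY, Matrix.mul_apply, ← mul_assoc]

/-- The unitary whose columns are the vectors of the product `Y` basis. -/
def yUnitary (n : ℕ) : Op n := tensor fun _ => yMat

theorem yUnitary_mul_conjTranspose (n : ℕ) : yUnitary n * (yUnitary n)ᴴ = 1 := by
  have h : (yUnitary n)ᴴ = tensor fun _ => yMatᴴ := by
    ext x y
    simp [yUnitary, tensor_apply, Matrix.conjTranspose_apply]
  rw [h, yUnitary, tensor_mul]
  simp only [yMat_mul_conjTranspose, tensor_one]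

/-- The characters of `C₂ⁿ`. -/
def chi {n : ℕ} (g s : Bits n) : ℂ := ∏ i, (-1) ^ ((g i : ℕ) * (s i : ℕ))

theorem V_mul_yUnitary {n : ℕ} (g : Bits n) :
    V g * yUnitary n = yUnitary n * Matrix.diagonal (chi g) := by
  rw [V, yUnitary, tensor_mul]
  simp only [sigmaY_pow_mul_yMat]
  rw [← tensor_mul, tensor_diagonal]
  rfl

/-- Orthogonality of characters: the sum over C₂ⁿ factors into one sum per qubit. -/
theorem sum_chi_mul_chi {n : ℕ} (s t : Bits n) :
    ∑ g, chi g s * chi g t = if s = t then 2 ^ n else 0 := by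
  have h : ∑ g, chi g s * chi g t =
      ∏ i, ∑ k : Fin 2, (-1 : ℂ) ^ ((k : ℕ) * (s i : ℕ)) * (-1) ^ ((k : ℕ) * (t i : ℕ)) := by
    rw [Finset.prod_univ_sum, Fintype.piFinset_univ]
    simp only [chi, Finset.prod_mul_distrib]
  have h2 : ∀ a b : Fin 2, ∑ k : Fin 2, (-1 : ℂ) ^ ((k : ℕ) * (a : ℕ)) * (-1) ^ ((k : ℕ) * (b : ℕ))
      = if a = b then 2 else 0 := by
    intro a b
    fin_cases a <;> fin_cases b <;> norm_num
  rw [h]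
  simp only [h2]
  split_ifs with hst
  · subst hst; simp
  · obtain ⟨i, hi⟩ := Function.ne_iff.mp hst
    exact Finset.prod_eq_zero (Finset.mem_univ i) (if_neg hi)

theorem V_eq {n : ℕ} (g : Bits n) :
    V g = yUnitary n * Matrix.diagonal (chi g) * (yUnitary n)ᴴ := by
  rw [← V_mul_yUnitary, mul_assoc, yUnitary_mul_conjTranspose, mul_one]

theorem IsRealYDiagonalUnitary.exists_diagonal {n : ℕ} {U : Op n} (hU : IsRealYDiagonalUnitary U) :
    ∃ μ : Bits n → ℂ, U = yUnitary n * Matrix.diagonal μ * (yUnitary n)ᴴ := by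
  choose μ hμ using hU.yDiagonal
  refine ⟨μ, ?_⟩
  have h : U * yUnitary n = yUnitary n * Matrix.diagonal μ := by
    ext x s
    have := congrFun (hμ s) x
    rw [Matrix.mul_diagonal, mul_comm]
    exact this
  rw [← h, mul_assoc, yUnitary_mul_conjTranspose, mul_one]

/-- The expansion `U = ∑ f, c(f) V(f)`. -/
theorem IsRealYDiagonalUnitary.eq_sum {n : ℕ} {U : Op n} (hU : IsRealYDiagonalUnitary U) :
    U = ∑ g, coeff U g • V g := by
  obtain ⟨μ, hμ⟩ := hU.exists_diagonal
  have hF := yUnitary_mul_conjTranspose n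
  have hF' := mul_eq_one_comm.mp hF
  have hc : ∀ g, coeff U g = ((2 : ℂ) ^ n)⁻¹ * ∑ s, chi g s * μ s := by
    intro g
    rw [coeff, hμ, ← mul_assoc, ← mul_assoc, V_mul_yUnitary, Matrix.trace_mul_comm,
      ← mul_assoc, ← mul_assoc, hF', one_mul, Matrix.diagonal_mul_diagonal, Matrix.trace_diagonal]
  -- Fourier inversion on C₂ⁿ: by `hc` the coefficients are the transform of the eigenvalues.
  have hd : Matrix.diagonal μ = ∑ g, coeff U g • Matrix.diagonal (chi g) := by
    ext s t
    rw [Matrix.sum_apply]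
    simp only [Matrix.smul_apply, Matrix.diagonal_apply]
    split_ifs with h
    · subst h
      have h2 : ((2 : ℂ) ^ n) ≠ 0 := pow_ne_zero _ two_ne_zero
      calc μ s = ((2 : ℂ) ^ n)⁻¹ * ∑ t, μ t * ∑ g, chi g t * chi g s := by
            simp [sum_chi_mul_chi, mul_comm, h2]
        _ = _ := by
            simp only [hc, smul_eq_mul, Finset.mul_sum, Finset.sum_mul]
            rw [Finset.sum_comm]
            refine Finset.sum_congr rfl fun _ _ => Finset.sum_congr rfl fun _ _ => ?_
            ring
    · simp
  conv_lhs => rw [hμ, hd, Finset.mul_sum, Finset.sum_mul]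
  refine Finset.sum_congr rfl fun g _ => ?_
  rw [V_eq g, Matrix.mul_smul, Matrix.smul_mul]

/-! ### The invariant bilinear form -/

/-- The matrix `σ_y^{⊗n}`, as a bilinear form. -/
def spinFlip (n : ℕ) : Op n := V (allOne n)

/-- Reality turns unitarity into UᵀU = 1, and a combination of the commuting operators V(f) commutes
with σ_y^{⊗n}, which is one of them. -/
theorem IsRealYDiagonalUnitary.transpose_flip {n : ℕ} {U : Op n} (hU : IsRealYDiagonalUnitary U) :
    Uᵀ * spinFlip n * U = spinFlip n := by
  have ht : Uᵀ * U = 1 := by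
    rw [← Matrix.mem_unitaryGroup_iff'.mp hU.unitary]
    congr 1
    ext x y
    simp [Matrix.star_apply, Complex.ext_iff, hU.real]
  have hcomm : spinFlip n * U = U * spinFlip n := by
    conv_lhs => rw [hU.eq_sum]
    conv_rhs => rw [hU.eq_sum]
    rw [Finset.mul_sum, Finset.sum_mul]
    refine Finset.sum_congr rfl fun g _ => ?_
    rw [Matrix.mul_smul, Matrix.smul_mul, spinFlip, V, V, tensor_mul, tensor_mul]
    simp only [← pow_add, add_comm]
  rw [mul_assoc, hcomm, ← mul_assoc, ht, one_mul]

/-- The sign by which `R_z(jπ/2)` and `R_y(jπ)` differ from their values at `j = 1`. -/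
theorem rotations_eq {j : ℕ} (hj : j = 1 ∨ j = 3) : ∃ ε : ℂ, (ε = 1 ∨ ε = -1) ∧
    Rz (j * Real.pi / 2) = Matrix.diagonal ![1, ε * Complex.I] ∧
    Ry (j * Real.pi) = ε • Ry Real.pi := by
  have h3 : Real.pi * 3 / 2 = Real.pi + Real.pi / 2 := by ring
  rcases hj with rfl | rfl
  · refine ⟨1, Or.inl rfl, ?_, by simp⟩
    ext a b
    fin_cases a <;> fin_cases b <;>
      simp [Rz, Complex.exp_pi_div_two_mul_I]
  · refine ⟨-1, Or.inr rfl, ?_, ?_⟩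
    · have : Complex.exp ((3 : ℂ) * Real.pi / 2 * Complex.I) = -Complex.I := by
        rw [show (3 : ℂ) * Real.pi / 2 * Complex.I
          = Real.pi * Complex.I + Real.pi / 2 * Complex.I by ring, Complex.exp_add]
        simp [Complex.exp_pi_div_two_mul_I]
      ext a b
      fin_cases a <;> fin_cases b <;> simp [Rz, this]
    · ext a b
      have hs : Real.sin (3 * Real.pi / 2) = -1 := by
        rw [mul_comm, h3, Real.sin_add]; simp
      have hc : Real.cos (3 * Real.pi / 2) = 0 := by
        rw [mul_comm, h3, Real.cos_add]; simp
      fin_cases a <;> fin_cases b <;> simp [Ry, -Complex.ofReal_sin, -Complex.ofReal_cos, hs, hc]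

/-- The diagonal of σ_y vanishes, so one common bit kills the whole product. -/
theorem flip_apply_eq_zero {n : ℕ} {x y : Bits n} (i : Fin n) (h : x i = y i) :
    spinFlip n x y = 0 := by
  refine Finset.prod_eq_zero (Finset.mem_univ i) ?_
  rw [h]
  generalize y i = b
  fin_cases b <;> simp [sigmaY, allOne]

/-- Where the form is nonzero the bits at i differ, so exactly one of the two diagonal factors is w.
-/
theorem onQubit_transpose_flip {n : ℕ} (i : Fin n) (w : ℂ) :
    (onQubit i (Matrix.diagonal ![1, w]))ᵀ * spinFlip n * onQubit i (Matrix.diagonal ![1, w])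
      = w • spinFlip n := by
  rw [onQubit_diagonal, Matrix.diagonal_transpose]
  ext x y
  rw [Matrix.mul_diagonal, Matrix.diagonal_mul, Matrix.smul_apply, smul_eq_mul]
  by_cases h : x i = y i
  · simp [flip_apply_eq_zero i h]
  · have : (![1, w] : Fin 2 → ℂ) (x i) * (![1, w] : Fin 2 → ℂ) (y i) = w := by
      revert h
      generalize x i = a
      generalize y i = b
      fin_cases a <;> fin_cases b <;> simp
    rw [mul_right_comm, this]

theorem logical_transpose_flip {n : ℕ} (p : Circuit n) :
    ∃ w : ℂ, w ≠ 0 ∧ (logical p)ᵀ * spinFlip n * logical p = w • spinFlip n := by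
  induction p with
  | nil => exact ⟨1, one_ne_zero, by simp [logical]⟩
  | cons s p ih =>
    obtain ⟨w, hw, h⟩ := ih
    have hs : ∃ v : ℂ, v ≠ 0 ∧ s.logicalᵀ * spinFlip n * s.logical = v • spinFlip n := by
      cases s with
      | ydiag U hU => exact ⟨1, one_ne_zero, by simpa [Step.logical] using hU.transpose_flip⟩
      | rz i j hj =>
        obtain ⟨ε, hε, hz, -⟩ := rotations_eq hj
        refine ⟨ε * Complex.I, ?_, ?_⟩
        · rcases hε with rfl | rfl <;> simp
        · rw [Step.logical, hz, onQubit_transpose_flip]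
    obtain ⟨v, hv, h'⟩ := hs
    refine ⟨w * v, mul_ne_zero hw hv, ?_⟩
    calc _ = s.logicalᵀ * ((logical p)ᵀ * spinFlip n * logical p) * s.logical := by
          simp only [logical, Matrix.transpose_mul, mul_assoc]
      _ = _ := by rw [h, Matrix.mul_smul, Matrix.smul_mul, h', smul_smul]

/-- The bilinear form of `σ_y^{⊗n}` is invariant up to a scalar. -/
theorem logical_form {n : ℕ} (p : Circuit n) : ∃ w : ℂ, w ≠ 0 ∧ ∀ ψ φ : Bits n → ℂ,
    (logical p *ᵥ ψ) ⬝ᵥ spinFlip n *ᵥ (logical p *ᵥ φ) = w * (ψ ⬝ᵥ spinFlip n *ᵥ φ) := by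
  obtain ⟨w, hw, h⟩ := logical_transpose_flip p
  refine ⟨w, hw, fun ψ φ => ?_⟩
  rw [Matrix.mulVec_mulVec, ← Matrix.vecMul_transpose, ← Matrix.dotProduct_mulVec,
    Matrix.mulVec_mulVec, ← mul_assoc, h, Matrix.smul_mulVec, dotProduct_smul, smul_eq_mul]

theorem ket_form {n : ℕ} (x y : Bits n) : ket x ⬝ᵥ spinFlip n *ᵥ ket y = spinFlip n x y := by
  simp [ket]

theorem flip_zero_one_ne {n : ℕ} : spinFlip n (allZero n) (allOne n) ≠ 0 := by
  rw [spinFlip, V, tensor_apply, Finset.prod_ne_zero_iff]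
  simp [sigmaY, allZero, allOne]

/-- Transposing each σ_y costs a sign, and (-1)ⁿ = 1. -/
theorem flip_one_zero {n : ℕ} (h : Even n) :
    spinFlip n (allOne n) (allZero n) = spinFlip n (allZero n) (allOne n) := by
  simp [spinFlip, V, tensor_apply, sigmaY, allZero, allOne, h.neg_pow]

/-- No circuit takes `|0⋯0⟩` and `|1⋯1⟩` to multiples of themselves and of `|0⋯01⟩`. -/
theorem logical_not_lastOne {n : ℕ} (hn : 1 < n) (p : Circuit n) (a b : ℂ)
    (ha : logical p *ᵥ ket (allZero n) = a • ket (allZero n))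
    (hb : logical p *ᵥ ket (allOne n) = b • ket (lastOne n)) : False := by
  obtain ⟨w, hw, h⟩ := logical_form p
  have := h (ket (allZero n)) (ket (allOne n))
  -- The images share bit 0, which is not the last bit since n > 1; so their pairing vanishes.
  rw [ha, hb, Matrix.mulVec_smul, smul_dotProduct, dotProduct_smul, ket_form, ket_form,
    flip_apply_eq_zero ⟨0, by omega⟩ (by simp [allZero, lastOne]; omega)] at this
  exact mul_ne_zero hw flip_zero_one_ne (by simpa using this.symm)

/-- For even `n`, no circuit takes `|0⋯0⟩` to a multiple of `|0⋯0⟩ + |1⋯1⟩`. -/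
theorem logical_not_plus {n : ℕ} (hn : 1 < n) (he : Even n) (p : Circuit n) (a : ℂ)
    (ha : logical p *ᵥ ket (allZero n) = a • (ket (allZero n) + ket (allOne n))) : False := by
  obtain ⟨w, hw, h⟩ := logical_form p
  have h0 := h (ket (allZero n)) (ket (allZero n))
  have h1 := h (ket (allZero n)) (ket (allOne n))
  rw [ha] at h0 h1
  have i : Fin n := ⟨0, by omega⟩
  have hz : spinFlip n (allZero n) (allZero n) = 0 := flip_apply_eq_zero i rfl
  have ho : spinFlip n (allOne n) (allOne n) = 0 := flip_apply_eq_zero i rfl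
  simp only [Matrix.mulVec_smul, Matrix.mulVec_add, smul_dotProduct, dotProduct_smul,
    add_dotProduct, dotProduct_add, ket_form, hz, ho, flip_one_zero he, smul_eq_mul] at h0
  have hne := flip_zero_one_ne (n := n)
  -- The source |0…0⟩ is isotropic, while its image pairs with itself to 2a² S(|0…0⟩, |1…1⟩).
  have : a = 0 := by
    by_contra hne'
    have : a * (a * (2 * spinFlip n (allZero n) (allOne n))) = 0 := by linear_combination h0
    simp [hne, hne'] at this
  -- With a = 0 the image of |0…0⟩ is zero, but its pairing with the image of |1…1⟩ must be w times
  -- a nonzero number.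
  rw [this, zero_smul, zero_dotProduct, ket_form] at h1
  exact mul_ne_zero hw hne h1.symm

/-! ### Pauli corrections -/

/-- The pending correction on one data qubit. -/
def pauli (a b : Fin 2) : Matrix (Fin 2) (Fin 2) ℂ := sigmaX ^ (a : ℕ) * sigmaZ ^ (b : ℕ)

/-- The pending corrections on the data qubits. -/
def PauliList.op {n : ℕ} (Q : PauliList n) : Op n := tensor fun i => pauli (Q.x i) (Q.z i)

/-- The state `Φ` with the pending corrections of `Q` not yet undone. -/
def PauliList.frame {n : ℕ} (Q : PauliList n) (Φ : Matrix (Bits n) (Fin 2) ℂ) :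
    Matrix (Bits n) (Fin 2) ℂ :=
  Q.op * Φ * ((Ry Real.pi) ^ (Q.w : ℕ))ᵀ

theorem Ry_pi : Ry Real.pi = !![0, -1; 1, 0] := by
  ext a b
  fin_cases a <;> fin_cases b <;> simp [Ry]

theorem Ry_pi_div_two : Ry (Real.pi / 2) =
    !![(Real.sqrt 2 : ℂ)⁻¹, -(Real.sqrt 2 : ℂ)⁻¹; (Real.sqrt 2 : ℂ)⁻¹, (Real.sqrt 2 : ℂ)⁻¹] := by
  have h : Real.pi / 2 / 2 = Real.pi / 4 := by ring
  have h2 : Real.sqrt 2 / 2 = (Real.sqrt 2)⁻¹ := by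
    rw [div_eq_iff two_ne_zero, inv_mul_eq_div, Real.div_sqrt]
  rw [Ry, h, Real.cos_pi_div_four, Real.sin_pi_div_four, h2, Complex.ofReal_inv]

/-- Up to a scalar σ_y is XZ, and reordering Paulis costs only signs. -/
theorem pauli_mul_sigmaY_pow (a b s : Fin 2) : ∃ k : ℂ, k ≠ 0 ∧
    pauli a b * sigmaY ^ (s : ℕ) = k • pauli (a + s) (b + s) := by
  fin_cases s
  · exact ⟨1, one_ne_zero, by simp⟩
  · fin_cases a <;> fin_cases b
    · refine ⟨-Complex.I * -1, by simp, ?_⟩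
      ext u v
      fin_cases u <;> fin_cases v <;> simp [pauli, sigmaX, sigmaY, sigmaZ]
    · refine ⟨-Complex.I, by simp, ?_⟩
      ext u v
      fin_cases u <;> fin_cases v <;> simp [pauli, sigmaX, sigmaY, sigmaZ]
    · refine ⟨Complex.I, by simp, ?_⟩
      ext u v
      fin_cases u <;> fin_cases v <;> simp [pauli, sigmaX, sigmaY, sigmaZ]
    · refine ⟨-Complex.I, by simp, ?_⟩
      ext u v
      fin_cases u <;> fin_cases v <;> simp [pauli, sigmaX, sigmaY, sigmaZ]

theorem PauliList.op_mul_V {n : ℕ} (Q : PauliList n) (s : Bits n) : ∃ k : ℂ, k ≠ 0 ∧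
    Q.op * V s = k • (Q.afterGadgets s).op := by
  choose k hk h using fun i => pauli_mul_sigmaY_pow (Q.x i) (Q.z i) (s i)
  refine ⟨∏ i, k i, Finset.prod_ne_zero_iff.mpr fun i _ => hk i, ?_⟩
  rw [PauliList.op, V, tensor_mul]
  simp only [h]
  exact tensor_smul _ _

theorem V_mul_V {n : ℕ} (f g : Bits n) : V f * V g = V (f + g) := by
  rw [V, V, tensor_mul]
  congr 1
  funext i
  have h : ∀ a b : Fin 2, sigmaY ^ (a : ℕ) * sigmaY ^ (b : ℕ) = sigmaY ^ ((a + b : Fin 2) : ℕ) := by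
    intro a b
    have h2 : sigmaY * sigmaY = 1 := by
      ext u v
      fin_cases u <;> fin_cases v <;> simp [sigmaY]
    fin_cases a <;> fin_cases b <;> simp [h2]
  exact h _ _

/-! ### A layer of gadgets -/

/-- Bob's local gate as the diagonal of a matrix. -/
def bobPhase (a b m k : Fin 2) : ℂ :=
  (if m = 0 then Complex.I else -Complex.I) ^ (k : ℕ) * (-1) ^ ((k : ℕ) * ((a + b : Fin 2) : ℕ))

theorem bobLocal_eq {n : ℕ} (Q : PauliList n) (m : Bits n) :
    bobLocal Q m = Matrix.diagonal fun b => ∏ i, bobPhase (Q.x i) (Q.z i) (m i) (b i) := by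
  rw [← tensor_diagonal, bobLocal]
  congr 1
  funext i
  -- The phase depends on the two correction bits only through their sum, which shortens the case
  -- check.
  rw [show bobPhase (Q.x i) (Q.z i) (m i) = bobPhase 0 (Q.x i + Q.z i) (m i) by
    funext k; simp [bobPhase]]
  generalize Q.x i + Q.z i = a
  generalize m i = c
  ext u v
  fin_cases a <;> fin_cases c <;> fin_cases u <;> fin_cases v <;>
    simp [bobPhase, gateP, sigmaZ, Matrix.mul_apply, Matrix.conjTranspose_apply]

/-- One gadget, before Bob's final operation, undoes the sign caused by the pending corrections. -/
theorem gadget_qubit (a b m k : Fin 2) :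
    (bobPhase a b m k * Ry (Real.pi / 2) m k * (Real.sqrt 2 : ℂ)⁻¹) •
      ((Complex.I • sigmaY) ^ (k : ℕ) * pauli a b)
      = (2⁻¹ : ℂ) • (pauli a b * sigmaY ^ (k : ℕ)) := by
  rw [mul_assoc, Ry_pi_div_two]
  ext u v
  fin_cases a <;> fin_cases b <;> fin_cases m <;> fin_cases k <;> fin_cases u <;> fin_cases v <;>
    simp [bobPhase, pauli, sigmaX, sigmaY, sigmaZ, inv_sqrt_two_mul_self] <;>
    simp [mul_comm]

theorem prod_epr {n : ℕ} (a b : Bits n) (r : ℂ) :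
    (∏ i, if a i = b i then r else 0) = if a = b then ∏ _i : Fin n, r else 0 := by
  split_ifs with h
  · subst h; simp
  · obtain ⟨i, hi⟩ := Function.ne_iff.mp h
    exact Finset.prod_eq_zero (Finset.mem_univ i) (if_neg hi)

/-- `gadgets` on matrices. -/
def gadgetsMat {n : ℕ} (U : Op n) (Q : PauliList n) (m s : Bits n)
    (Φ : Matrix (Bits n) (Fin 2) ℂ) : Matrix (Bits n) (Fin 2) ℂ :=
  Matrix.of (gadgets U Q m s (Matrix.of.symm Φ))

/-- The EPR pairs force Alice's control bits to equal Bob's, so only the term a = b survives. -/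
theorem aliceMeasure_apply {n : ℕ} (m : Bits n) (Φ : Matrix (Bits n) (Fin 2) ℂ) (x : Bits n)
    (p : Fin 2) (b : Bits n) :
    aliceMeasure m (aliceControlled (attachEPR (Matrix.of.symm Φ))) x p b =
      (∏ i, Ry (Real.pi / 2) (m i) (b i)) * (∏ _i : Fin n, (Real.sqrt 2 : ℂ)⁻¹) *
        (tensor (fun i => (Complex.I • sigmaY) ^ (b i : ℕ)) * Φ) x p := by
  simp only [aliceMeasure, aliceControlled, attachEPR, prod_epr]
  rw [Finset.sum_eq_single b]
  · simp only [if_true, Matrix.mul_apply, Finset.mul_sum, tensor_apply]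
    refine Finset.sum_congr rfl fun y _ => ?_
    rw [Matrix.of_symm_apply]
    ring
  · intro a _ ha
    simp [ha]
  · simp

theorem gadgetsMat_eq_sum {n : ℕ} (U : Op n) (Q : PauliList n) (m s : Bits n)
    (Φ : Matrix (Bits n) (Fin 2) ℂ) :
    gadgetsMat U Q m s Φ = ∑ b, (coeff U (-s + b) * ∏ i, (bobPhase (Q.x i) (Q.z i) (m i) (b i) *
      Ry (Real.pi / 2) (m i) (b i) * (Real.sqrt 2 : ℂ)⁻¹)) •
        (tensor (fun i => (Complex.I • sigmaY) ^ (b i : ℕ)) * Φ) := by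
  ext x p
  rw [Matrix.sum_apply, gadgetsMat, Matrix.of_apply, gadgets, bobMeasure]
  refine Finset.sum_congr rfl fun b _ => ?_
  rw [aliceMeasure_apply, bobLocal_eq, Matrix.mul_diagonal, Matrix.smul_apply, smul_eq_mul,
    bobC, Matrix.of_apply, Finset.prod_mul_distrib, Finset.prod_mul_distrib]
  simp only [mul_assoc]

/-- By `gadget_qubit`, Bob's local gates cancel both the dependence on Alice's outcome and the sign
from moving σ_y past the pending Pauli. His outcome s only translates the coefficients, which
amounts to an extra V(s), and this is absorbed into the corrections. -/
theorem gadgets_frame {n : ℕ} {U : Op n} (hU : IsRealYDiagonalUnitary U) (Q : PauliList n)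
    (m s : Bits n) : ∃ k : ℂ, k ≠ 0 ∧ ∀ (c : ℂ) (Φ : Matrix (Bits n) (Fin 2) ℂ),
      gadgetsMat U Q m s (c • Q.frame Φ) = (k * c) • (Q.afterGadgets s).frame (U * Φ) := by
  obtain ⟨k, hk, hkV⟩ := Q.op_mul_V s
  refine ⟨(∏ _i : Fin n, 2⁻¹) * k, mul_ne_zero (by simp) hk, fun c Φ => ?_⟩
  have hb : ∀ b : Bits n, (∏ i, (bobPhase (Q.x i) (Q.z i) (m i) (b i) *
      Ry (Real.pi / 2) (m i) (b i) * (Real.sqrt 2 : ℂ)⁻¹)) •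
        (tensor (fun i => (Complex.I • sigmaY) ^ (b i : ℕ)) * Q.op) =
      (∏ _i : Fin n, (2⁻¹ : ℂ)) • (Q.op * V b) := by
    intro b
    rw [PauliList.op, V, tensor_mul, tensor_mul, ← tensor_smul, ← tensor_smul]
    simp only [gadget_qubit]
  -- Translating the index by s multiplies by V(s), since V represents C₂ⁿ.
  have hs : ∑ b, coeff U (-s + b) • V b = V s * U := by
    conv_rhs => rw [hU.eq_sum, Finset.mul_sum]
    rw [← Equiv.sum_comp (Equiv.addLeft s)]
    refine Finset.sum_congr rfl fun b _ => ?_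
    rw [Matrix.mul_smul, V_mul_V]
    simp
  have key : ∑ b, (coeff U (-s + b) * ∏ i, (bobPhase (Q.x i) (Q.z i) (m i) (b i) *
      Ry (Real.pi / 2) (m i) (b i) * (Real.sqrt 2 : ℂ)⁻¹)) •
        (tensor (fun i => (Complex.I • sigmaY) ^ (b i : ℕ)) * Q.op) =
      ((∏ _i : Fin n, (2⁻¹ : ℂ)) * k) • ((Q.afterGadgets s).op * U) := by
    rw [mul_smul, ← Matrix.smul_mul, ← hkV, mul_assoc, ← hs, Finset.mul_sum, Finset.smul_sum]
    refine Finset.sum_congr rfl fun b _ => ?_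
    rw [mul_smul, hb, Matrix.mul_smul, smul_comm]
  calc gadgetsMat U Q m s (c • Q.frame Φ)
      = c • ((∑ b, (coeff U (-s + b) * ∏ i, (bobPhase (Q.x i) (Q.z i) (m i) (b i) *
          Ry (Real.pi / 2) (m i) (b i) * (Real.sqrt 2 : ℂ)⁻¹)) •
            (tensor (fun i => (Complex.I • sigmaY) ^ (b i : ℕ)) * Q.op)) *
              Φ * (Ry Real.pi ^ (Q.w : ℕ))ᵀ) := by
        rw [gadgetsMat_eq_sum, PauliList.frame, Matrix.sum_mul, Matrix.sum_mul, Finset.smul_sum]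
        refine Finset.sum_congr rfl fun b _ => ?_
        simp only [Matrix.mul_smul, Matrix.smul_mul, Matrix.mul_assoc]
        rw [smul_comm]
    _ = _ := by
        rw [key, PauliList.frame, mul_comm _ c, mul_smul]
        simp only [Matrix.smul_mul, Matrix.mul_assoc, smul_smul, PauliList.afterGadgets]

/-! ### Controlled rotations of the phase qubit -/

/-- The projection onto the value `k` of data qubit `i`. -/
def proj {n : ℕ} (i : Fin n) (k : Fin 2) : Op n := Matrix.diagonal fun x => if x i = k then 1 else 0

/-- `controlledRy` on matrices. -/
def controlledMat {n : ℕ} (i : Fin n) (j : ℕ) (Φ : Matrix (Bits n) (Fin 2) ℂ) :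
    Matrix (Bits n) (Fin 2) ℂ :=
  Matrix.of (controlledRy i j (Matrix.of.symm Φ))

theorem controlledMat_eq {n : ℕ} (i : Fin n) (j : ℕ) (Φ : Matrix (Bits n) (Fin 2) ℂ) :
    controlledMat i j Φ = proj i 0 * Φ + proj i 1 * Φ * (Ry (j * Real.pi))ᵀ := by
  ext x p
  rw [Matrix.add_apply, Matrix.mul_apply (M := proj i 1 * Φ), proj, proj, Matrix.diagonal_mul]
  simp only [Matrix.diagonal_mul, controlledMat, controlledRy, Matrix.transpose_apply,
    Matrix.of_apply, Matrix.of_symm_apply]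
  generalize x i = a
  fin_cases a
  · simp [Matrix.one_apply]
  · simp [mul_comm]

theorem pauli_apply_eq_zero {a b u v : Fin 2} (h : v ≠ u + a) : pauli a b u v = 0 := by
  revert h
  fin_cases a <;> fin_cases b <;> fin_cases u <;> fin_cases v <;>
    simp [pauli, sigmaX, sigmaZ]

/-- An X on qubit i exchanges the two projections; Z commutes with them. -/
theorem proj_mul_op {n : ℕ} (Q : PauliList n) (i : Fin n) (k : Fin 2) :
    proj i k * Q.op = Q.op * proj i (k + Q.x i) := by
  ext x y
  rw [proj, proj, Matrix.mul_diagonal, Matrix.diagonal_mul]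
  by_cases h : y i = x i + Q.x i
  · simp [h, mul_comm]
  · have : Q.op x y = 0 := Finset.prod_eq_zero (Finset.mem_univ i) (pauli_apply_eq_zero h)
    simp [this]

theorem op_afterControlled {n : ℕ} (Q : PauliList n) (i : Fin n) (h : Q.x i = 1) :
    (Q.afterControlled i).op = Q.op * (proj i 0 - proj i 1) := by
  have hz : sigmaZ = Matrix.diagonal ![1, -1] := by
    ext u v
    fin_cases u <;> fin_cases v <;> simp [sigmaZ]
  have hp : proj i 0 - proj i 1 = onQubit i sigmaZ := by
    rw [hz, onQubit_diagonal, proj, proj, Matrix.diagonal_sub]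
    congr 1
    funext x
    generalize x i = a
    fin_cases a <;> simp
  rw [hp, PauliList.op, PauliList.op, onQubit, tensor_mul]
  congr 1
  funext k
  rcases eq_or_ne k i with rfl | hk
  · have hzz : sigmaZ * sigmaZ = 1 := by
      rw [hz, Matrix.diagonal_mul_diagonal]
      ext u v
      fin_cases u <;> fin_cases v <;> simp
    simp only [PauliList.afterControlled, Function.update_self, h, pauli]
    generalize Q.z k = b
    fin_cases b <;> simp [mul_assoc, hzz]
  · simp [PauliList.afterControlled, hk]

theorem Ry_pi_mul_self : Ry Real.pi * Ry Real.pi = -1 := by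
  rw [Ry_pi]
  ext u v
  fin_cases u <;> fin_cases v <;> simp

theorem Ry_pi_pow_succ (w : Fin 2) : ∃ k : ℂ, k ≠ 0 ∧
    Ry Real.pi ^ (w : ℕ) * Ry Real.pi = k • Ry Real.pi ^ ((w + 1 : Fin 2) : ℕ) := by
  fin_cases w
  · exact ⟨1, one_ne_zero, by simp⟩
  · exact ⟨-1, by simp, by simp [Ry_pi_mul_self]⟩

/-- Without an X on the control, everything commutes. With one, the rotation acts on the wrong
branch; since R_y(π)² = -1, this equals the intended gate followed by Z on the control and R_y(π) on
the phase qubit, up to a scalar. -/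
theorem controlledMat_frame {n : ℕ} (i : Fin n) {j : ℕ} (hj : j = 1 ∨ j = 3) (Q : PauliList n) :
    ∃ k : ℂ, k ≠ 0 ∧ ∀ (c : ℂ) (Φ : Matrix (Bits n) (Fin 2) ℂ),
      controlledMat i j (c • Q.frame Φ) =
        (k * c) • (Q.afterControlled i).frame (controlledMat i j Φ) := by
  obtain ⟨ε, hε, -, hR⟩ := rotations_eq hj
  have hε2 : ε * ε = 1 := by rcases hε with rfl | rfl <;> norm_num
  have hε0 : ε ≠ 0 := by rintro rfl; simp at hε2
  have hsplit : Q.x i = 0 ∨ Q.x i = 1 := by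
    generalize Q.x i = a
    fin_cases a <;> simp
  have hcomm : Ry Real.pi ^ (Q.w : ℕ) * Ry Real.pi = Ry Real.pi * Ry Real.pi ^ (Q.w : ℕ) :=
    (Commute.self_pow _ _).symm.eq
  rcases hsplit with h | h
  · have hQ : Q.afterControlled i = Q := by
      simp [PauliList.afterControlled, h]
    refine ⟨1, one_ne_zero, fun c Φ => ?_⟩
    rw [hQ, one_mul, controlledMat_eq, controlledMat_eq, hR]
    simp only [PauliList.frame, Matrix.mul_smul, Matrix.smul_mul, Matrix.transpose_smul,
      Matrix.mul_add, Matrix.add_mul, smul_add, ← Matrix.mul_assoc, proj_mul_op, h, add_zero]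
    simp only [Matrix.mul_assoc, ← Matrix.transpose_mul, hcomm, smul_comm ε c]
  · obtain ⟨k, hk, hk'⟩ := Ry_pi_pow_succ Q.w
    refine ⟨ε * k, mul_ne_zero hε0 hk, fun c Φ => ?_⟩
    have h00 : proj i 0 * proj i 0 = proj i 0 := by simp [proj, Matrix.diagonal_mul_diagonal]
    have h11 : proj i 1 * proj i 1 = proj i 1 := by simp [proj, Matrix.diagonal_mul_diagonal]
    have h01 : proj i 0 * proj i 1 = 0 := by
      rw [proj, proj, Matrix.diagonal_mul_diagonal, ← Matrix.diagonal_zero]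
      congr 1; funext x; generalize x i = a; fin_cases a <;> simp
    have h10 : proj i 1 * proj i 0 = 0 := by
      rw [proj, proj, Matrix.diagonal_mul_diagonal, ← Matrix.diagonal_zero]
      congr 1; funext x; generalize x i = a; fin_cases a <;> simp
    have hw : (Q.afterControlled i).w = Q.w + 1 := by simp [PauliList.afterControlled, h]
    have hkt : k • (Ry Real.pi ^ ((Q.w + 1 : Fin 2) : ℕ))ᵀ
        = (Ry Real.pi)ᵀ * (Ry Real.pi ^ (Q.w : ℕ))ᵀ := by
      rw [← Matrix.transpose_mul, hk', Matrix.transpose_smul]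
    have hct : (Ry Real.pi)ᵀ * (Ry Real.pi ^ (Q.w : ℕ))ᵀ
        = (Ry Real.pi ^ (Q.w : ℕ))ᵀ * (Ry Real.pi)ᵀ := by
      rw [← Matrix.transpose_mul, ← Matrix.transpose_mul, hcomm]
    have hJJ : (Ry Real.pi)ᵀ * (Ry Real.pi)ᵀ = -1 := by
      rw [← Matrix.transpose_mul, Ry_pi_mul_self]; simp
    have hop : proj i 0 * Q.op = Q.op * proj i 1 := by
      rw [proj_mul_op, h, zero_add]
    have hop' : proj i 1 * Q.op = Q.op * proj i 0 := by
      rw [proj_mul_op, h]; rfl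
    -- The factor P₀ - P₁ is the new Z on the control; its sign compensates for R_y(π)² = -1.
    have hsq : (proj i 0 - proj i 1) * (proj i 0 * Φ + proj i 1 * Φ * (ε • Ry Real.pi)ᵀ)
        = proj i 0 * Φ - ε • (proj i 1 * Φ * (Ry Real.pi)ᵀ) := by
      simp only [Matrix.sub_mul, Matrix.mul_add, ← Matrix.mul_assoc, h00, h01, h10, h11]
      simp [sub_eq_add_neg]
    calc controlledMat i j (c • Q.frame Φ)
        = c • (Q.op * (proj i 1 * Φ) * (Ry Real.pi ^ (Q.w : ℕ))ᵀ
          + ε • (Q.op * (proj i 0 * Φ) * ((Ry Real.pi ^ (Q.w : ℕ))ᵀ * (Ry Real.pi)ᵀ))) := by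
          rw [controlledMat_eq, hR]
          simp only [PauliList.frame, Matrix.mul_smul, Matrix.smul_mul, Matrix.transpose_smul,
            smul_add, ← Matrix.mul_assoc, hop, hop']
          rw [smul_comm]
      _ = c • ε • (Q.op * (proj i 0 * Φ - ε • (proj i 1 * Φ * (Ry Real.pi)ᵀ)) *
            ((Ry Real.pi)ᵀ * (Ry Real.pi ^ (Q.w : ℕ))ᵀ)) := by
          congr 1
          simp only [Matrix.mul_sub, Matrix.sub_mul, smul_sub, Matrix.mul_smul, Matrix.smul_mul,
            smul_smul, hε2, one_smul]
          have : Q.op * (proj i 1 * Φ * (Ry Real.pi)ᵀ) *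
              ((Ry Real.pi)ᵀ * (Ry Real.pi ^ (Q.w : ℕ))ᵀ) =
              -(Q.op * (proj i 1 * Φ) * (Ry Real.pi ^ (Q.w : ℕ))ᵀ) := by
            rw [← Matrix.mul_assoc Q.op, Matrix.mul_assoc (Q.op * (proj i 1 * Φ)),
              ← Matrix.mul_assoc (Ry Real.pi)ᵀ, hJJ]
            simp
          rw [this, hct, sub_neg_eq_add, add_comm]
      _ = _ := by
          rw [PauliList.frame, op_afterControlled Q i h, hw, controlledMat_eq, hR,
            Matrix.mul_assoc Q.op (proj i 0 - proj i 1), hsq, ← hkt]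
          simp only [Matrix.mul_smul, smul_smul]
          congr 1
          ring

/-! ### The encoding -/

/-- `encode` as a matrix. -/
def encodeMat {n : ℕ} (ψ : Bits n → ℂ) : Matrix (Bits n) (Fin 2) ℂ := Matrix.of (encode ψ)

/-- A real matrix acts on real and imaginary parts separately, hence commutes with the encoding. -/
theorem mul_encodeMat {n : ℕ} {U : Op n} (hU : ∀ x y, (U x y).im = 0) (ψ : Bits n → ℂ) :
    U * encodeMat ψ = encodeMat (U *ᵥ ψ) := by
  have hre : ∀ x y, U x y = ((U x y).re : ℂ) := fun x y => by simp [Complex.ext_iff, hU]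
  ext x p
  rw [Matrix.mul_apply]
  simp only [encodeMat, Matrix.of_apply, encode, Matrix.mulVec, dotProduct]
  split_ifs
  · rw [Complex.re_sum, Complex.ofReal_sum]
    refine Finset.sum_congr rfl fun y _ => ?_
    rw [Complex.mul_re, hU, zero_mul, sub_zero, Complex.ofReal_mul, ← hre]
  · rw [Complex.im_sum, Complex.ofReal_sum]
    refine Finset.sum_congr rfl fun y _ => ?_
    rw [Complex.mul_im, hU, zero_mul, add_zero, Complex.ofReal_mul, ← hre]

/-- Multiplying an amplitude by ±i rotates its pair (Re, Im) by a quarter turn, which is R_y(±π) on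
the phase qubit. -/
theorem controlledMat_encodeMat {n : ℕ} (i : Fin n) {j : ℕ} (hj : j = 1 ∨ j = 3) (ψ : Bits n → ℂ) :
    controlledMat i j (encodeMat ψ) = encodeMat (onQubit i (Rz (j * Real.pi / 2)) *ᵥ ψ) := by
  obtain ⟨ε, hε, hz, hR⟩ := rotations_eq hj
  rw [hz, onQubit_diagonal]
  ext x p
  simp only [controlledMat, encodeMat, Matrix.of_apply, Equiv.symm_apply_apply, controlledRy, hR, Ry_pi, encode, Matrix.mulVec_diagonal]
  generalize x i = a
  rcases hε with rfl | rfl <;> fin_cases a <;> fin_cases p <;> simp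

/-- Real encodings determine the state up to a scalar. -/
theorem eq_smul_of_encode_eq {n : ℕ} {ψ φ : Bits n → ℂ} {c : ℂ} (h : encode ψ = c • encode φ) :
    ∃ r : ℂ, ψ = r • φ := by
  -- Encodings have real entries, so taking real parts replaces c by Re c.
  refine ⟨(c.re : ℂ), funext fun x => ?_⟩
  have h0 := congrArg Complex.re (congrFun (congrFun h x) 0)
  have h1 := congrArg Complex.re (congrFun (congrFun h x) 1)
  simp [encode] at h0 h1
  simp [Complex.ext_iff, h0, h1]

/-! ### The whole run -/

/-- `correct` on matrices. -/
def correctMat {n : ℕ} (Q : PauliList n) (Φ : Matrix (Bits n) (Fin 2) ℂ) :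
    Matrix (Bits n) (Fin 2) ℂ :=
  Matrix.of (correct Q (Matrix.of.symm Φ))

theorem correctMat_frame {n : ℕ} (Q : PauliList n) (c : ℂ) (Φ : Matrix (Bits n) (Fin 2) ℂ) :
    correctMat Q (c • Q.frame Φ) = c • Φ := by
  have hc : ∀ Ψ : Matrix (Bits n) (Fin 2) ℂ, correctMat Q Ψ =
      tensor (fun i => sigmaZ ^ (Q.z i : ℕ) * sigmaX ^ (Q.x i : ℕ)) * Ψ *
        (((Ry Real.pi)ᴴ) ^ (Q.w : ℕ))ᵀ := by
    intro Ψ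
    ext x p
    simp only [correctMat, Matrix.of_apply, Matrix.of_symm_apply, correct, Matrix.mul_apply, Finset.sum_mul, Matrix.transpose_apply]
    rw [Finset.sum_comm]
    refine Finset.sum_congr rfl fun q _ => Finset.sum_congr rfl fun y _ => ?_
    ring
  have hx : sigmaX * sigmaX = 1 := by
    ext u v
    fin_cases u <;> fin_cases v <;> simp [sigmaX]
  have hz : sigmaZ * sigmaZ = 1 := by
    ext u v
    fin_cases u <;> fin_cases v <;> simp [sigmaZ]
  have hq : ∀ a b : Fin 2, sigmaZ ^ (b : ℕ) * sigmaX ^ (a : ℕ) * pauli a b = 1 := by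
    intro a b
    have hxx : sigmaX ^ (a : ℕ) * sigmaX ^ (a : ℕ) = 1 := by fin_cases a <;> simp [hx]
    have hzz : sigmaZ ^ (b : ℕ) * sigmaZ ^ (b : ℕ) = 1 := by fin_cases b <;> simp [hz]
    rw [pauli, mul_assoc, ← mul_assoc (sigmaX ^ (a : ℕ)), hxx, one_mul, hzz]
  have hop : tensor (fun i => sigmaZ ^ (Q.z i : ℕ) * sigmaX ^ (Q.x i : ℕ)) * Q.op = 1 := by
    rw [PauliList.op, tensor_mul]
    simp only [hq, tensor_one]
  have hw : (Ry Real.pi ^ (Q.w : ℕ))ᵀ * (((Ry Real.pi)ᴴ) ^ (Q.w : ℕ))ᵀ = 1 := by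
    have : (Ry Real.pi)ᴴ * Ry Real.pi = 1 := by
      rw [Ry_pi]
      ext u v
      fin_cases u <;> fin_cases v <;> simp [Matrix.mul_apply]
    rw [← Matrix.transpose_mul]
    generalize Q.w = w
    fin_cases w <;> simp [this]
  rw [hc, PauliList.frame, Matrix.mul_smul, Matrix.smul_mul, Matrix.mul_assoc, Matrix.mul_assoc,
    Matrix.mul_assoc, hw, Matrix.mul_one, ← Matrix.mul_assoc, hop, Matrix.one_mul]

/-- `run` on matrices. -/
def runMat {n : ℕ} (p : Circuit n) (o : ℕ → Bits n × Bits n) (Q : PauliList n)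
    (Φ : Matrix (Bits n) (Fin 2) ℂ) : Matrix (Bits n) (Fin 2) ℂ :=
  Matrix.of (run p o Q (Matrix.of.symm Φ))

/-- The outcomes and corrections stay general because both change along the induction; the
accumulated scalar is carried in c. -/
theorem run_frame {n : ℕ} (p : Circuit n) : ∀ (o : ℕ → Bits n × Bits n) (Q : PauliList n),
    ∃ k : ℂ, k ≠ 0 ∧ ∀ (c : ℂ) (ψ : Bits n → ℂ),
      runMat p o Q (c • Q.frame (encodeMat ψ)) = (k * c) • encodeMat (logical p *ᵥ ψ) := by
  induction p with
  | nil =>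
    intro o Q
    refine ⟨1, one_ne_zero, fun c ψ => ?_⟩
    rw [logical, Matrix.one_mulVec, one_mul]
    exact correctMat_frame Q c _
  | cons s p ih =>
    intro o Q
    cases s with
    | ydiag U hU =>
      obtain ⟨k, hk, h⟩ := gadgets_frame hU Q (o 0).1 (o 0).2
      obtain ⟨l, hl, h'⟩ := ih (fun k => o (k + 1)) (Q.afterGadgets (o 0).2)
      refine ⟨l * k, mul_ne_zero hl hk, fun c ψ => ?_⟩
      calc _ = runMat p (fun k => o (k + 1)) (Q.afterGadgets (o 0).2)
              (gadgetsMat U Q (o 0).1 (o 0).2 (c • Q.frame (encodeMat ψ))) := rfl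
        _ = _ := by
          rw [h, mul_encodeMat hU.real, h', Matrix.mulVec_mulVec, mul_assoc]
          rfl
    | rz i j hj =>
      obtain ⟨k, hk, h⟩ := controlledMat_frame i hj Q
      obtain ⟨l, hl, h'⟩ := ih o (Q.afterControlled i)
      refine ⟨l * k, mul_ne_zero hl hk, fun c ψ => ?_⟩
      calc _ = runMat p o (Q.afterControlled i)
              (controlledMat i j (c • Q.frame (encodeMat ψ))) := rfl
        _ = _ := by
          rw [h, controlledMat_encodeMat i hj, h', Matrix.mulVec_mulVec, mul_assoc]
          rfl

/-- The scheme is correct: for all outcomes the output is the encoding of the logical output, up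
to a nonzero scalar. -/
theorem output_eq {n : ℕ} (p : Circuit n) (o : ℕ → Bits n × Bits n) : ∃ k : ℂ, k ≠ 0 ∧
    ∀ ψ : Bits n → ℂ, output p o ψ = k • encode (logical p *ᵥ ψ) := by
  obtain ⟨k, hk, h⟩ := run_frame p o (PauliList.none n)
  refine ⟨k, hk, fun ψ => ?_⟩
  have := h 1 ψ
  have hop : (PauliList.none n).op = 1 := by
    simp [PauliList.op, PauliList.none, pauli, tensor_one]
  have hf : (PauliList.none n).frame (encodeMat ψ) = encodeMat ψ := by
    rw [PauliList.frame, hop, Matrix.one_mul]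
    simp [PauliList.none]
  rw [hf, one_smul, mul_one] at this
  exact this

theorem SchemeMaps.exists_smul {n : ℕ} {p : Circuit n} {ψ φ : Bits n → ℂ}
    (h : SchemeMaps p ψ φ) : ∃ r : ℂ, logical p *ᵥ ψ = r • φ := by
  -- Any single outcome sequence suffices: since k ≠ 0, the output is a nonzero multiple of the
  -- encoded logical output.
  obtain ⟨c, θ, hc⟩ := h fun _ => (0, 0)
  obtain ⟨k, hk, ho⟩ := output_eq p fun _ => (0, 0)
  rw [ho] at hc
  have : encode (logical p *ᵥ ψ) = (k⁻¹ * c) • encode (Complex.exp (θ * Complex.I) • φ) := by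
    rw [mul_smul, ← hc, smul_smul, inv_mul_cancel₀ hk, one_smul]
  obtain ⟨r, hr⟩ := eq_smul_of_encode_eq this
  exact ⟨r * Complex.exp (θ * Complex.I), by rw [hr, smul_smul]⟩

theorem CircuitMaps.exists_smul {n : ℕ} {p : Circuit n} {ψ φ : Bits n → ℂ}
    (h : CircuitMaps p ψ φ) : ∃ r : ℂ, logical p *ᵥ ψ = r • φ := by
  obtain ⟨θ, h⟩ := h
  exact ⟨_, h⟩

/-! ### The exchange of `|1⋯1⟩` and `|0⋯01⟩` -/

/-- The permutation of basis states that exchanges `|1⋯1⟩` and `|0⋯01⟩`. -/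
def exchange (n : ℕ) : Op n := (Equiv.swap (allOne n) (lastOne n)).permMatrix ℂ

theorem exchange_mem (n : ℕ) : exchange n ∈ Matrix.unitaryGroup (Bits n) ℂ := by
  rw [Matrix.mem_unitaryGroup_iff, Matrix.star_eq_conjTranspose, exchange,
    Matrix.conjTranspose_permMatrix, ← Matrix.permMatrix_mul]
  simp

theorem exchange_mulVec_ket {n : ℕ} (x : Bits n) :
    exchange n *ᵥ ket x = ket (Equiv.swap (allOne n) (lastOne n) x) := by
  rw [exchange, Matrix.permMatrix_mulVec]
  funext y
  simp [ket, Pi.single_apply, Equiv.swap_apply_eq_iff]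

theorem exchange_allOne {n : ℕ} : exchange n *ᵥ ket (allOne n) = ket (lastOne n) := by
  rw [exchange_mulVec_ket, Equiv.swap_apply_left]

theorem exchange_allZero {n : ℕ} (hn : 1 < n) :
    exchange n *ᵥ ket (allZero n) = ket (allZero n) := by
  have h1 : allZero n ≠ allOne n := fun h => by
    simpa [allZero, allOne] using congrFun h ⟨0, by omega⟩
  have h2 : allZero n ≠ lastOne n := fun h => by
    have := congrFun h ⟨n - 1, by omega⟩
    simp [allZero, lastOne] at this
    omega
  rw [exchange_mulVec_ket, Equiv.swap_apply_of_ne_of_ne h1 h2]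

theorem sum_norm_ket {n : ℕ} (x : Bits n) : ∑ y, ‖ket x y‖ ^ 2 = 1 := by
  rw [Finset.sum_eq_single x]
  · simp [ket]
  · intro y _ hy; simp [ket, hy]
  · simp

end RebitScheme
end
open RebitScheme in
theorem theorem3 (n : ℕ) (hn : 1 < n) :
    (∃ W ∈ Matrix.unitaryGroup (Bits n) ℂ,
      ∀ p : Circuit n, ¬ CircuitIs p W ∧ ¬ SchemeRealizes p W) ∧
    (Even n → ∀ p : Circuit n,
      ¬ (CircuitMaps p (ket (allZero n))
            (((Real.sqrt 2)⁻¹ : ℂ) • (ket (allZero n) + ket (allOne n))) ∧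
          CircuitMaps p (ket (allOne n))
            (((Real.sqrt 2)⁻¹ : ℂ) • (ket (allZero n) - ket (allOne n)))) ∧
      ¬ (SchemeMaps p (ket (allZero n))
            (((Real.sqrt 2)⁻¹ : ℂ) • (ket (allZero n) + ket (allOne n))) ∧
          SchemeMaps p (ket (allOne n))
            (((Real.sqrt 2)⁻¹ : ℂ) • (ket (allZero n) - ket (allOne n))))) ∧
    (Odd n → ∀ p : Circuit n,
      ¬ (CircuitMaps p (ket (allZero n)) (ket (allZero n)) ∧
          CircuitMaps p (ket (allOne n)) (ket (lastOne n))) ∧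
      ¬ (SchemeMaps p (ket (allZero n)) (ket (allZero n)) ∧
          SchemeMaps p (ket (allOne n)) (ket (lastOne n)))) := by
  refine ⟨⟨exchange n, exchange_mem n, fun p => ⟨?_, ?_⟩⟩, fun he p => ⟨?_, ?_⟩,
    fun _ p => ⟨?_, ?_⟩⟩
  · rintro ⟨θ, h⟩
    refine logical_not_lastOne hn p (Complex.exp (θ * Complex.I)) (Complex.exp (θ * Complex.I))
      ?_ ?_
    · rw [h, Matrix.smul_mulVec, exchange_allZero hn]
    · rw [h, Matrix.smul_mulVec, exchange_allOne]
  · intro h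
    -- The phase in `SchemeMaps` may depend on the input, hence two unrelated scalars.
    obtain ⟨a, ha⟩ := (h _ (sum_norm_ket (allZero n))).exists_smul
    obtain ⟨b, hb⟩ := (h _ (sum_norm_ket (allOne n))).exists_smul
    rw [exchange_allZero hn] at ha
    rw [exchange_allOne] at hb
    exact logical_not_lastOne hn p a b ha hb
  · rintro ⟨h, -⟩
    obtain ⟨a, ha⟩ := h.exists_smul
    rw [smul_smul] at ha
    exact logical_not_plus hn he p _ ha
  · rintro ⟨h, -⟩
    obtain ⟨a, ha⟩ := h.exists_smul
    rw [smul_smul] at ha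
    exact logical_not_plus hn he p _ ha
  · rintro ⟨h, h'⟩
    obtain ⟨a, ha⟩ := h.exists_smul
    obtain ⟨b, hb⟩ := h'.exists_smul
    exact logical_not_lastOne hn p a b ha hb
  · rintro ⟨h, h'⟩
    obtain ⟨a, ha⟩ := h.exists_smul
    obtain ⟨b, hb⟩ := h'.exists_smul
    exact logical_not_lastOne hn p a b ha hb
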